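/- Let $\mathrm{Act}$ be an infinite set of visible actions, $\tau\notin \mathrm{Act}$ the silent action, and $(\mathbb P,\to)$ a labelled transition system over $\mathrm{Act}\cup\{\tau\}$ that is universal, i.e. every labelled transition system embeds injectively into it with an image closed under transitions and with exactly the same transitions. Let $p\stackrel{\sigma}{\Rightarrow}q$ ($\sigma\in \mathrm{Act}^*$) mean that $p$ can evolve into $q$ performing the visible actions of $\sigma$ and finitely many $\tau$'s in between. Let $\mathrm{divergences}(p)$ and $\mathrm{deadlocks}(p)$ be the sets of $\sigma\in \mathrm{Act}^*$ such that $p\stackrel{\sigma}{\Rightarrow}q$ for some $q$ from which there is an infinite path of $\tau$-transitions, respectively for some $q$ without outgoing transitions. Let $\inf(p)$ be the set of infinite sequences $a_1a_2\cdots$ with $p\stackrel{a_1}{\Rightarrow}p_1\stackrel{a_2}{\Rightarrow}p_2\cdots$ for some $p_1,p_2,\dots$, and $\mathrm{failures}(p)$ the set of pairs $\langle\sigma,X\rangle$ with $\sigma\in \mathrm{Act}^*$, $X\subseteq \mathrm{Act}$ such that $p\stackrel{\sigma}{\Rightarrow}q$ for some $q$ without outgoing transitions labelled in $X\cup\{\tau\}$.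 The complete traces of $p$ are the elements of $\inf(p)\cup\mathrm{divergences}(p)\cup\mathrm{deadlocks}(p)$. Put $$\mathrm{divergences}_\bot(p)=\{\sigma\rho\mid\sigma\in\mathrm{divergences}(p),\ \rho\in \mathrm{Act}^*\},$$ $$\mathrm{inf}_\bot(p)=\inf(p)\cup\{\sigma\rho\mid\sigma\in\mathrm{divergences}(p),\ \rho\in \mathrm{Act}^\infty\},$$ $$\mathrm{failures}_\bot(p)=\mathrm{failures}(p)\cup\{\langle\sigma\rho,X\rangle\mid\sigma\in\mathrm{divergences}(p),\ \rho\in \mathrm{Act}^*,\ X\subseteq \mathrm{Act}\},$$ and let $p\sqsubseteq^\bot_{FDI}q$ mean that $\mathrm{divergences}_\bot(p)\supseteq\mathrm{divergences}_\bot(q)$, $\mathrm{inf}_\bot(p)\supseteq\mathrm{inf}_\bot(q)$ and $\mathrm{failures}_\bot(p)\supseteq\mathrm{failures}_\bot(q)$. For $G\subseteq \mathrm{Act}^*$, a process satisfies the liveness property given by $G$ if each of its complete traces has a prefix in $G$. Let $\mathcal O$ consist of the following operators on $\mathbb P$: the CSP partially synchronous interleaving $\|_S$ ($S\subseteq \mathrm{Act}$),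 which synchronises on the actions in $S$ and interleaves all others; the abstraction operator $\tau_I$ ($I\subseteq \mathrm{Act}$), which turns the actions in $I$ into $\tau$; and the state operator $\lambda^m_s$, given by a set of internal states with current state $s$, which replaces each visible action $a$ by $\mathrm{action}(s,a)\in \mathrm{Act}$ while updating its state to $\mathrm{effect}(s,a)$, and leaves $\tau$ unchanged. A renaming operator is a state operator with only one internal state; it is injective if $\mathrm{action}$ is injective on $\mathrm{Act}$. For a set of operators $\mathcal O'\subseteq\mathcal O$, an $\mathcal O'$-context is a one-hole context built from operators in $\mathcal O'$ and arbitrary processes; a precongruence for $\mathcal O'$ is a preorder preserved by all $\mathcal O'$-contexts; it respects a property $\varphi$ if $p\sqsubseteq q$ and $p\models\varphi$ imply $q\models\varphi$. The preorder fully abstract with respect to liveness properties and $\mathcal O'$ is the coarsest precongruence for $\mathcal O'$ that respects all liveness properties. Let $p\sqsubseteq_{\mathrm{liveness}}q$ mean that for every $\mathcal O$-context $C$ and every liveness property $\varphi$, $C[p]\models\varphi$ implies $C[q]\models\varphi$. Theorem. (1) For all $p,q\in\mathbb P$: $p\sqsubseteq_{\mathrm{liveness}}q$ if and only if $p\sqsubseteq^\bot_{FDI}q$.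 (2) $\sqsubseteq^\bot_{FDI}$ is the preorder that is fully abstract with respect to liveness properties and $\mathcal O$. (3) The same holds already for every $\mathcal O'\subseteq\mathcal O$ that contains all injective renaming operators and, for at least one $g\in \mathrm{Act}$, the operator $\|_{\mathrm{Act}\setminus\{g\}}$; in particular for the class of all $\|_S$ and all injective renaming operators. -/

import Mathlib

universe u v w x

/-! Labelled transition systems over an alphabet `Act` of visible actions.  A label is an element
of `Option Act`; `none` is the silent action `τ`, and `some a` is the visible action `a`. -/

/-- A labelled transition system. -/
structure LTS (Act : Type u) where
  State : Type w
  Tr : State → Option Act → State → Prop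

/-- `Act^ω`: the finite (`Sum.inl`) and the infinite (`Sum.inr`) sequences over `Act`. -/
abbrev ActSeq (Act : Type u) : Type u := List Act ⊕ Stream' Act

/-- The finite sequence `ρ` is a prefix of the finite or infinite sequence `σ`. -/
def IsPrefixOf {Act : Type u} (ρ : List Act) : ActSeq Act → Prop
  | Sum.inl σ => ∃ ν : List Act, ρ ++ ν = σ
  | Sum.inr σ => ∃ ν : Stream' Act, ρ ++ₛ ν = σ

namespace LTS

variable {Act : Type u}

/-- `L.Universal`: every LTS whose states form a type in the universe `v` embeds into `L`, such
that the image of the embedding is closed under the transitions of `L`. -/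
def Universal (L : LTS.{u, w} Act) : Prop :=
  ∀ Q : LTS.{u, v} Act, ∃ f : Q.State → L.State, Function.Injective f ∧
    ∀ (q : Q.State) (α : Option Act) (p' : L.State),
      L.Tr (f q) α p' ↔ ∃ q' : Q.State, p' = f q' ∧ Q.Tr q α q'

section Traces

variable (L : LTS.{u, w} Act)

/-- `L.Weak p σ q`: the process `p` can evolve into `q` while performing the sequence `σ` of
visible actions, interspersed with any finite number of silent actions. -/
inductive Weak : L.State → List Act → L.State → Prop
  | refl (p : L.State) : Weak p [] p
  | tau {p q : L.State} : L.Tr p none q → Weak p [] q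
  | act {p q : L.State} {a : Act} : L.Tr p (some a) q → Weak p [a] q
  | trans {p q r : L.State} {σ ρ : List Act} : Weak p σ q → Weak q ρ r → Weak p (σ ++ ρ) r

/-- `p` has no outgoing transition. -/
def Deadlocks (p : L.State) : Prop := ∀ (α : Option Act) (q : L.State), ¬ L.Tr p α q

/-- `p` has an infinite path of silent transitions. -/
def Diverges (p : L.State) : Prop :=
  ∃ s : ℕ → L.State, s 0 = p ∧ ∀ i, L.Tr (s i) none (s (i + 1))

def infTraces (p : L.State) : Set (Stream' Act) :=
  {σ | ∃ s : ℕ → L.State, s 0 = p ∧ ∀ i, L.Weak (s i) [σ.get i] (s (i + 1))}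

def deadlockTraces (p : L.State) : Set (List Act) :=
  {σ | ∃ q, L.Weak p σ q ∧ L.Deadlocks q}

def divergences (p : L.State) : Set (List Act) :=
  {σ | ∃ q, L.Weak p σ q ∧ L.Diverges q}

/-- The complete traces of `p`. -/
def completeTraces (p : L.State) : Set (ActSeq Act) :=
  Sum.inr '' L.infTraces p ∪ Sum.inl '' L.divergences p ∪ Sum.inl '' L.deadlockTraces p

/-- The labels of the outgoing transitions of `p`. -/
def initials (p : L.State) : Set (Option Act) := {α | ∃ q, L.Tr p α q}

def failures (p : L.State) : Set (List Act × Set Act) :=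
  {φ | ∃ q, L.Weak p φ.1 q ∧ L.initials q ∩ (some '' φ.2 ∪ {none}) = ∅}

/-- The flooded divergences of `p`. -/
def divergencesBot (p : L.State) : Set (List Act) :=
  {τ | ∃ σ ∈ L.divergences p, ∃ ρ : List Act, τ = σ ++ ρ}

/-- The flooded infinite traces of `p`. -/
def infBot (p : L.State) : Set (Stream' Act) :=
  L.infTraces p ∪ {τ | ∃ σ ∈ L.divergences p, ∃ ρ : Stream' Act, τ = σ ++ₛ ρ}

/-- The flooded failures of `p`. -/
def failuresBot (p : L.State) : Set (List Act × Set Act) :=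
  L.failures p ∪ {φ | ∃ σ ∈ L.divergences p, ∃ (ρ : List Act) (X : Set Act), φ = (σ ++ ρ, X)}

/-- The flooded failures/divergences/infinite-traces preorder. -/
def FDIBot (p q : L.State) : Prop :=
  L.divergencesBot p ⊇ L.divergencesBot q ∧
  L.infBot p ⊇ L.infBot q ∧
  L.failuresBot p ⊇ L.failuresBot q

/-- `p` satisfies the liveness property given by `G`: each complete trace of `p` has a prefix
in `G`. -/
def SatisfiesLiveness (p : L.State) (G : Set (List Act)) : Prop :=
  ∀ σ ∈ L.completeTraces p, ∃ ρ ∈ G, IsPrefixOf ρ σ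

/-- The class of all liveness properties, a property being the set of processes that have it. -/
def livenessProperties : Set (Set L.State) :=
  {φ | ∃ G : Set (List Act), φ = {p | L.SatisfiesLiveness p G}}

end Traces

end LTS

/-- An interface specification of a state operator: a set `S` of internal states, and functions
that rename an action and that update the internal state. -/
structure Interface (Act : Type u) where
  S : Type x
  action : S → Act → Act
  effect : S → Act → S

/-- The interface specification with a single internal state that renames `a` into `f a`. -/
def Interface.renaming {Act : Type u} (f : Act → Act) : Interface.{u, x} Act where
  S := PUnit
  action _ a := f a
  effect s _ := s

namespace LTS

variable {Act : Type u}

section Rules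

variable (L : LTS.{u, w} Act)

/-- The structural rules of partially synchronous interleaving. -/
inductive ParStep (par : Set Act → L.State → L.State → L.State) (S : Set Act) :
    L.State → L.State → Option Act → L.State → Prop
  | left {p p' q : L.State} {α : Option Act} :
      L.Tr p α p' → α ∉ some '' S → ParStep par S p q α (par S p' q)
  | right {p q q' : L.State} {α : Option Act} :
      L.Tr q α q' → α ∉ some '' S → ParStep par S p q α (par S p q')
  | sync {p p' q q' : L.State} {a : Act} :
      L.Tr p (some a) p' → L.Tr q (some a) q' → a ∈ S →
        ParStep par S p q (some a) (par S p' q')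

/-- The structural rules of abstraction. -/
inductive HideStep (hide : Set Act → L.State → L.State) (I : Set Act) :
    L.State → Option Act → L.State → Prop
  | keep {p p' : L.State} {α : Option Act} :
      L.Tr p α p' → α ∉ some '' I → HideStep hide I p α (hide I p')
  | conceal {p p' : L.State} {a : Act} :
      L.Tr p (some a) p' → a ∈ I → HideStep hide I p none (hide I p')

/-- The structural rules of the state operator. -/
inductive StateStep (lam : (m : Interface.{u, x} Act) → m.S → L.State → L.State)
    (m : Interface.{u, x} Act) : m.S → L.State → Option Act → L.State → Prop
  | silent {s : m.S} {p p' : L.State} :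
      L.Tr p none p' → StateStep lam m s p none (lam m s p')
  | visible {s : m.S} {p p' : L.State} {a : Act} :
      L.Tr p (some a) p' → StateStep lam m s p (some (m.action s a)) (lam m (m.effect s a) p')

/-- Partially synchronous interleaving `p ‖_S q`, abstraction `τ_I(p)` and the state operator
`λ^m_s(p)` as operators on the processes of `L`: a composed process has exactly the transitions
that can be inferred by the structural rules. -/
structure Operators where
  par : Set Act → L.State → L.State → L.State
  hide : Set Act → L.State → L.State
  lam : (m : Interface.{u, x} Act) → m.S → L.State → L.State
  par_iff : ∀ S p q α t, L.Tr (par S p q) α t ↔ L.ParStep par S p q α t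
  hide_iff : ∀ I p α t, L.Tr (hide I p) α t ↔ L.HideStep hide I p α t
  lam_iff : ∀ m s p α t, L.Tr (lam m s p) α t ↔ L.StateStep lam m s p α t

end Rules

end LTS

/-- Names of the operators `‖_S`, `τ_I` and `λ^m_s`. -/
inductive Oper (Act : Type u) where
  | par (S : Set Act)
  | hide (I : Set Act)
  | lam (m : Interface.{u, x} Act) (s : m.S)

/-- The class of all three kinds of operators. -/
def Oper.all (Act : Type u) : Set (Oper.{u, x} Act) := Set.univ

/-- The operator `‖_{Act \ {g}}` and all injective renaming operators. -/
def Oper.syncRenaming {Act : Type u} (g : Act) : Set (Oper.{u, x} Act) :=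
  {Oper.par {g}ᶜ} ∪
    {o | ∃ f : Act → Act, Function.Injective f ∧ o = Oper.lam (Interface.renaming f) PUnit.unit}

namespace LTS

variable {Act : Type u} (L : LTS.{u, w} Act)

/-- Contexts with one hole, built from operators in `O` and arbitrary processes of `L`. -/
inductive Context (O : Set (Oper.{u, x} Act)) where
  | hole : Context O
  | parLeft (S : Set Act) (h : Oper.par S ∈ O) (C : Context O) (r : L.State) : Context O
  | parRight (S : Set Act) (h : Oper.par S ∈ O) (r : L.State) (C : Context O) : Context O
  | hide (I : Set Act) (h : Oper.hide I ∈ O) (C : Context O) : Context O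
  | lam (m : Interface.{u, x} Act) (s : m.S) (h : Oper.lam m s ∈ O) (C : Context O) : Context O

variable {L}

/-- `C.fill ops p` is the process `C[p]`. -/
def Context.fill {O : Set (Oper.{u, x} Act)} (ops : Operators.{u, w, x} L) :
    Context.{u, w, x} L O → L.State → L.State
  | .hole, p => p
  | .parLeft S _ C r, p => ops.par S (C.fill ops p) r
  | .parRight S _ r C, p => ops.par S r (C.fill ops p)
  | .hide I _ C, p => ops.hide I (C.fill ops p)
  | .lam m s _ C, p => ops.lam m s (C.fill ops p)

/-- `R` is a preorder that is preserved by all contexts built from operators in `O`. -/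
structure IsPrecongruence (ops : Operators.{u, w, x} L) (O : Set (Oper.{u, x} Act))
    (R : L.State → L.State → Prop) : Prop where
  refl : ∀ p, R p p
  trans : ∀ p q r, R p q → R q r → R p r
  closed : ∀ (C : Context L O) (p q : L.State), R p q → R (C.fill ops p) (C.fill ops q)

/-- `R` respects (preserves) the good properties in the class `𝒢`. -/
def Respects (R : L.State → L.State → Prop) (𝒢 : Set (Set L.State)) : Prop :=
  ∀ p q, R p q → ∀ φ ∈ 𝒢, p ∈ φ → q ∈ φ

/-- `R` is fully abstract with respect to `𝒢` and `O`: it is the coarsest precongruence for `O`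
that respects the properties in `𝒢`. -/
structure IsFullyAbstract (ops : Operators.{u, w, x} L) (O : Set (Oper.{u, x} Act))
    (𝒢 : Set (Set L.State)) (R : L.State → L.State → Prop) : Prop where
  precongruence : IsPrecongruence ops O R
  respects : Respects R 𝒢
  coarsest : ∀ R' : L.State → L.State → Prop,
    IsPrecongruence ops O R' → Respects R' 𝒢 → ∀ p q, R' p q → R p q

/-- The contextual description of the preorder that is fully abstract with respect to `𝒢`
and `O`. -/
def ContextualPreorder (ops : Operators.{u, w, x} L) (O : Set (Oper.{u, x} Act))
    (𝒢 : Set (Set L.State)) (p q : L.State) : Prop :=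
  ∀ C : Context L O, ∀ φ ∈ 𝒢, C.fill ops p ∈ φ → C.fill ops q ∈ φ

/-- The preorder that is fully abstract with respect to the class of liveness properties and all
three kinds of operators. -/
def LivenessPreorder (ops : Operators.{u, w, x} L) : L.State → L.State → Prop :=
  ContextualPreorder ops (Oper.all Act) L.livenessProperties

end LTS

/-! A universal LTS and the operators on it, built explicitly: its processes are the LTSs (with
states in the universe `v`) with a distinguished state. -/

structure PointedLTS (Act : Type u) where
  lts : LTS.{u, v} Act
  init : lts.State

namespace PointedLTS

variable {Act : Type u}

/-- The LTS of all pointed LTSs; a transition moves the distinguished state. -/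
def universalLTS (Act : Type u) : LTS.{u, max u (v + 1)} Act where
  State := PointedLTS.{u, v} Act
  Tr p α p' := ∃ s, p.lts.Tr p.init α s ∧ p' = ⟨p.lts, s⟩

theorem universalLTS_universal (Act : Type u) :
    LTS.Universal.{u, v, max u (v + 1)} (universalLTS.{u, v} Act) := by
  intro Q
  refine ⟨fun q => ⟨Q, q⟩, ?_, ?_⟩
  · intro a b h
    exact eq_of_heq (PointedLTS.mk.inj h).2
  · intro q α p'
    constructor
    · rintro ⟨s, hs, rfl⟩
      exact ⟨s, rfl, hs⟩
    · rintro ⟨s, rfl, hs⟩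
      exact ⟨s, hs, rfl⟩

def parProc (S : Set Act) (p q : PointedLTS.{u, v} Act) : PointedLTS.{u, v} Act where
  lts :=
    { State := p.lts.State × q.lts.State
      Tr := fun a α b =>
        (p.lts.Tr a.1 α b.1 ∧ a.2 = b.2 ∧ α ∉ some '' S) ∨
        (q.lts.Tr a.2 α b.2 ∧ a.1 = b.1 ∧ α ∉ some '' S) ∨
        (p.lts.Tr a.1 α b.1 ∧ q.lts.Tr a.2 α b.2 ∧ α ∈ some '' S) }
  init := (p.init, q.init)

def hideProc (I : Set Act) (p : PointedLTS.{u, v} Act) : PointedLTS.{u, v} Act where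
  lts :=
    { State := p.lts.State
      Tr := fun a α b =>
        (p.lts.Tr a α b ∧ α ∉ some '' I) ∨ (α = none ∧ ∃ c ∈ I, p.lts.Tr a (some c) b) }
  init := p.init

def lamProc (m : Interface.{u, v} Act) (s : m.S) (p : PointedLTS.{u, v} Act) :
    PointedLTS.{u, v} Act where
  lts :=
    { State := m.S × p.lts.State
      Tr := fun a α b =>
        (α = none ∧ p.lts.Tr a.2 none b.2 ∧ b.1 = a.1) ∨
        (∃ c, α = some (m.action a.1 c) ∧ p.lts.Tr a.2 (some c) b.2 ∧ b.1 = m.effect a.1 c) }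
  init := (s, p.init)

/-- The three operators on the universal LTS of pointed LTSs. -/
def universalOperators (Act : Type u) :
    LTS.Operators.{u, max u (v + 1), v} (universalLTS.{u, v} Act) where
  par := parProc
  hide := hideProc
  lam := lamProc
  par_iff S p q α t := by
    constructor
    · rintro ⟨⟨s₁, s₂⟩, h, rfl⟩
      rcases h with ⟨h₁, h₂, h₃⟩ | ⟨h₁, h₂, h₃⟩ | ⟨h₁, h₂, a, ha, rfl⟩
      · obtain rfl : q.init = s₂ := h₂
        exact LTS.ParStep.left (L := universalLTS Act) (par := parProc) ⟨s₁, h₁, rfl⟩ h₃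
      · obtain rfl : p.init = s₁ := h₂
        exact LTS.ParStep.right (L := universalLTS Act) (par := parProc) ⟨s₂, h₁, rfl⟩ h₃
      · exact LTS.ParStep.sync (L := universalLTS Act) (par := parProc)
          ⟨s₁, h₁, rfl⟩ ⟨s₂, h₂, rfl⟩ ha
    · rintro (⟨⟨s, h, rfl⟩, hα⟩ | ⟨⟨s, h, rfl⟩, hα⟩ | ⟨⟨s₁, h₁, rfl⟩, ⟨s₂, h₂, rfl⟩, ha⟩)
      · exact ⟨(s, q.init), Or.inl ⟨h, rfl, hα⟩, rfl⟩
      · exact ⟨(p.init, s), Or.inr (Or.inl ⟨h, rfl, hα⟩), rfl⟩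
      · exact ⟨(s₁, s₂), Or.inr (Or.inr ⟨h₁, h₂, _, ha, rfl⟩), rfl⟩
  hide_iff I p α t := by
    constructor
    · rintro ⟨s, ⟨h, hα⟩ | ⟨rfl, c, hc, h⟩, rfl⟩
      · exact LTS.HideStep.keep (L := universalLTS Act) (hide := hideProc) (p := p)
          (p' := ⟨p.lts, s⟩) ⟨s, h, rfl⟩ hα
      · exact LTS.HideStep.conceal (L := universalLTS Act) (hide := hideProc) (p := p)
          (p' := ⟨p.lts, s⟩) ⟨s, h, rfl⟩ hc
    · rintro (⟨⟨s, h, rfl⟩, hα⟩ | ⟨⟨s, h, rfl⟩, ha⟩)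
      · exact ⟨s, Or.inl ⟨h, hα⟩, rfl⟩
      · exact ⟨s, Or.inr ⟨rfl, _, ha, h⟩, rfl⟩
  lam_iff m s p α t := by
    constructor
    · rintro ⟨⟨s₁, s₂⟩, ⟨rfl, h, h'⟩ | ⟨c, rfl, h, h'⟩, rfl⟩
      · obtain rfl : s₁ = s := h'
        exact LTS.StateStep.silent (L := universalLTS Act) (lam := lamProc) ⟨s₂, h, rfl⟩
      · obtain rfl : s₁ = m.effect s c := h'
        exact LTS.StateStep.visible (L := universalLTS Act) (lam := lamProc) ⟨s₂, h, rfl⟩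
    · rintro (⟨⟨s', h, rfl⟩⟩ | ⟨⟨s', h, rfl⟩⟩)
      · exact ⟨(s, s'), Or.inl ⟨rfl, h, rfl⟩, rfl⟩
      · exact ⟨(_, s'), Or.inr ⟨_, rfl, h, rfl⟩, rfl⟩

end PointedLTS

-- Soundness. In each argument position, every operator acts as a control that reads the visible
-- actions of the process in the hole (`Transducer`, `Realizes`). A computation of the composed
-- process thus splits into a run of the control and a weak computation of the argument. By
-- `FDIBot.exists_replay`, an infinite sequence of weak steps of `q` can be replayed by `p` with the
-- same words, unless `p` has a flooded divergence along it. A replay recombines with the run of the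
-- control, and a divergence of the argument floods the output as well. This gives
-- `Realizes.fdiBot`, one argument for all operators. Liveness is respected because flooding only
-- adds extensions of divergences, which inherit a prefix in `G`.
--
-- Completeness. Rename the process by an injective `f` that misses `g`, synchronise it on all
-- actions but `g` with a test that follows a word, and take the liveness property of visibly
-- departing from that word. By `not_satisfiesLiveness_deviating_iff` it fails exactly if there is a
-- divergence along the word, the word is an infinite trace, or the composition deadlocks along the
-- word. If the test offers `g`, which needs no partner, deadlock is impossible; if it offers `f ''
-- X` at the end of the word, deadlock there means stable refusal of `X`. So each divergence,
-- infinite trace and failure of `q` has a test that forces its flooded counterpart on `p`.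
-- Universality supplies the tests as processes, and a precongruence that respects liveness is
-- always contained in the contextual preorder.

universe y

/-! ### Dependent choice, and streams as concatenations of lists. -/

theorem exists_seq_of_step {X : Type*} {Q : ℕ → X → Prop} {R : ℕ → X → X → Prop} {x₀ : X}
    (h₀ : Q 0 x₀) (step : ∀ n y, Q n y → ∃ z, Q (n + 1) z ∧ R n y z) :
    ∃ f : ℕ → X, f 0 = x₀ ∧ (∀ n, Q n (f n)) ∧ ∀ n, R n (f n) (f (n + 1)) := by
  choose g hg using step
  let F : ∀ n, {y // Q n y} := fun n =>
    Nat.rec ⟨x₀, h₀⟩ (fun n y => ⟨g n y.1 y.2, (hg n y.1 y.2).1⟩) n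
  exact ⟨fun n => (F n).1, rfl, fun n => (F n).2, fun n => (hg n (F n).1 (F n).2).2⟩

theorem List.append_stream_cancel {α : Type*} (l : List α) {s t : Stream' α}
    (h : l ++ₛ s = l ++ₛ t) : s = t := by
  rw [← Stream'.drop_append_stream l s, h, Stream'.drop_append_stream]

theorem List.prefix_of_append_stream_eq {α : Type*} {l m : List α} {s t : Stream' α}
    (h : l ++ₛ s = m ++ₛ t) (hl : l.length ≤ m.length) : l <+: m := by
  induction l generalizing m with
  | nil => exact List.nil_prefix
  | cons a l ih =>
    cases m with
    | nil => simp at hl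
    | cons b m =>
      rw [Stream'.cons_append_stream, Stream'.cons_append_stream] at h
      obtain ⟨hab, h'⟩ := Stream'.cons_injective2 h
      exact List.cons_prefix_cons.2 ⟨hab, ih h' (by simpa using hl)⟩

/-- The concatenation of the first `n` members of a sequence of lists. -/
def concatUpTo {α : Type*} (l : ℕ → List α) : ℕ → List α
  | 0 => []
  | n + 1 => concatUpTo l n ++ l n

theorem concatUpTo_prefix {α : Type*} (l : ℕ → List α) {m n : ℕ} (h : m ≤ n) :
    concatUpTo l m <+: concatUpTo l n := by
  induction n, h using Nat.le_induction with
  | base => exact List.prefix_rfl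
  | succ n _ ih => exact ih.trans (List.prefix_append _ _)

theorem exists_lt_length_concatUpTo {α : Type*} {l : ℕ → List α}
    (h : ∀ N, ∃ n, N ≤ n ∧ l n ≠ []) (j : ℕ) : ∃ n, j < (concatUpTo l n).length := by
  induction j with
  | zero =>
    obtain ⟨n, -, hn⟩ := h 0
    exact ⟨n + 1, by simp [concatUpTo, List.length_pos_iff.2 hn]⟩
  | succ j ih =>
    obtain ⟨m, hm⟩ := ih
    obtain ⟨n, hmn, hn⟩ := h m
    have := (concatUpTo_prefix l hmn).length_le
    have := List.length_pos_iff.2 hn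
    exact ⟨n + 1, by simp only [concatUpTo, List.length_append]; omega⟩

/-- Infinitely many nonempty lists concatenate to a stream; `t n` is what remains of it after the
first `n` lists. -/
theorem exists_stream_concat {α : Type*} {l : ℕ → List α} (h : ∀ N, ∃ n, N ≤ n ∧ l n ≠ []) :
    ∃ t : ℕ → Stream' α, ∀ n, t n = l n ++ₛ t (n + 1) := by
  choose m hm using exists_lt_length_concatUpTo h
  -- Any partial concatenation longer than `j` gives the same letter, as these lists are prefixes of
  -- one another.
  let s : Stream' α := fun j => (concatUpTo l (m j))[j]'(hm j)
  have hs : ∀ n, concatUpTo l n = s.take (concatUpTo l n).length := by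
    intro n
    refine List.ext_getElem (by simp) fun j hj hj' => ?_
    have : (s.take (concatUpTo l n).length)[j]'hj' = (concatUpTo l (m j))[j]'(hm j) := by
      have := Stream'.getElem?_take (s := s) hj
      rw [List.getElem?_eq_getElem hj'] at this
      exact Option.some.inj this
    rw [this]
    rcases le_total n (m j) with hle | hle
    · exact (concatUpTo_prefix l hle).getElem hj
    · exact ((concatUpTo_prefix l hle).getElem (hm j)).symm
  have hs' : ∀ n, concatUpTo l n ++ₛ s.drop (concatUpTo l n).length = s := by
    intro n
    conv_lhs => enter [1]; rw [hs n]
    exact Stream'.append_take_drop _ _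
  refine ⟨fun n => s.drop (concatUpTo l n).length, fun n => ?_⟩
  refine List.append_stream_cancel (concatUpTo l n) ?_
  rw [← Stream'.append_append_stream, hs' n]
  exact (hs' (n + 1)).symm

theorem concatUpTo_append_stream {α : Type*} {l : ℕ → List α} {t : ℕ → Stream' α}
    (h : ∀ n, t n = l n ++ₛ t (n + 1)) (n : ℕ) : concatUpTo l n ++ₛ t n = t 0 := by
  induction n with
  | zero => rfl
  | succ n ih => rw [concatUpTo, Stream'.append_append_stream, ← h, ih]

theorem concatUpTo_singleton {α : Type*} (s : Stream' α) (n : ℕ) :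
    concatUpTo (fun i => [s.get i]) n = s.take n := by
  induction n with
  | zero => rfl
  | succ n ih => rw [concatUpTo, ih, Stream'.take_succ']

/-! ### Weak transitions, divergence and infinite traces. -/

namespace LTS

variable {Act : Type u} {L : LTS.{u, w} Act}

section Weak

theorem Weak.cons_tau {p p' q : L.State} {σ : List Act} (h : L.Tr p none p')
    (hw : L.Weak p' σ q) : L.Weak p σ q :=
  .trans (.tau h) hw

theorem Weak.cons_act {p p' q : L.State} {a : Act} {σ : List Act} (h : L.Tr p (some a) p')
    (hw : L.Weak p' σ q) : L.Weak p (a :: σ) q :=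
  .trans (.act h) hw

theorem Weak.append_nil {p q r : L.State} {σ : List Act} (h : L.Weak p σ q)
    (h' : L.Weak q [] r) : L.Weak p σ r := by
  simpa using h.trans h'

theorem Weak.concat {s : ℕ → L.State} {l : ℕ → List Act}
    (h : ∀ n, L.Weak (s n) (l n) (s (n + 1))) (n : ℕ) :
    L.Weak (s 0) (concatUpTo l n) (s n) := by
  induction n with
  | zero => exact .refl _
  | succ n ih => exact ih.trans (h n)

variable (L) in
/-- Sequences of single transitions that perform the visible actions of a list. -/
inductive Path : L.State → List Act → L.State → Prop
  | nil (p : L.State) : Path p [] p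
  | tau {p p' q : L.State} {σ : List Act} : L.Tr p none p' → Path p' σ q → Path p σ q
  | act {p p' q : L.State} {a : Act} {σ : List Act} :
      L.Tr p (some a) p' → Path p' σ q → Path p (a :: σ) q

theorem Path.trans {p q r : L.State} {σ ρ : List Act} (h : L.Path p σ q) (h' : L.Path q ρ r) :
    L.Path p (σ ++ ρ) r := by
  induction h with
  | nil => exact h'
  | tau h _ ih => exact .tau h (ih h')
  | act h _ ih => exact .act h (ih h')

theorem weak_iff_path {p q : L.State} {σ : List Act} : L.Weak p σ q ↔ L.Path p σ q := by
  constructor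
  · intro h
    induction h with
    | refl => exact .nil _
    | tau h => exact .tau h (.nil _)
    | act h => exact .act h (.nil _)
    | trans _ _ ih₁ ih₂ => exact ih₁.trans ih₂
  · intro h
    induction h with
    | nil => exact .refl _
    | tau h _ ih => exact .cons_tau h ih
    | act h _ ih => exact .cons_act h ih

theorem Weak.exists_act {p q : L.State} {a : Act} {σ : List Act} (h : L.Weak p (a :: σ) q) :
    ∃ p₁ p₂, L.Weak p [] p₁ ∧ L.Tr p₁ (some a) p₂ ∧ L.Weak p₂ σ q := by
  rw [weak_iff_path] at h
  generalize hρ : a :: σ = ρ at h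
  induction h with
  | nil => simp at hρ
  | tau h _ ih =>
    obtain ⟨p₁, p₂, h₁, h₂, h₃⟩ := ih hρ
    exact ⟨p₁, p₂, h₁.cons_tau h, h₂, h₃⟩
  | act h hp =>
    obtain ⟨rfl, rfl⟩ := List.cons.inj hρ
    exact ⟨_, _, .refl _, h, weak_iff_path.2 hp⟩

theorem Weak.split {p q : L.State} {σ ρ : List Act} (h : L.Weak p (σ ++ ρ) q) :
    ∃ r, L.Weak p σ r ∧ L.Weak r ρ q := by
  induction σ generalizing p with
  | nil => exact ⟨p, .refl _, h⟩
  | cons a σ ih =>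
    obtain ⟨p₁, p₂, h₁, h₂, h₃⟩ := h.exists_act
    obtain ⟨r, hr, hr'⟩ := ih h₃
    exact ⟨r, h₁.trans (hr.cons_act h₂), hr'⟩

theorem Weak.split_cons {p q : L.State} {a : Act} {σ : List Act} (h : L.Weak p (a :: σ) q) :
    ∃ r, L.Weak p [a] r ∧ L.Weak r σ q :=
  Weak.split (σ := [a]) h

end Weak

section Divergence

/-- If every state silently reachable from `p` had a silent transition, these could be chained
forever. -/
theorem exists_stable_of_not_diverges {p : L.State} (h : ¬ L.Diverges p) :
    ∃ q, L.Weak p [] q ∧ ∀ r, ¬ L.Tr q none r := by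
  by_contra! hc
  obtain ⟨f, h₀, -, h₁⟩ := exists_seq_of_step (Q := fun _ q => L.Weak p [] q)
    (R := fun _ q r => L.Tr q none r) (Weak.refl p) fun n q hq => by
      obtain ⟨r, hr⟩ := hc q hq
      exact ⟨r, hq.trans (.tau hr), hr⟩
  exact h ⟨f, h₀, h₁⟩

/-- A sequence of weak silent steps infinitely many of which contain a transition gives rise to
a divergence. -/
theorem diverges_of_weak {t : ℕ → L.State} (h : ∀ n, L.Weak (t n) [] (t (n + 1)))
    (h' : ∀ N, ∃ n, N ≤ n ∧ ∃ y z, L.Weak (t n) [] y ∧ L.Tr y none z ∧ L.Weak z [] (t (n + 1))) :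
    L.Diverges (t 0) := by
  have mono : ∀ m n, m ≤ n → L.Weak (t m) [] (t n) := by
    intro m n hmn
    induction n, hmn using Nat.le_induction with
    | base => exact .refl _
    | succ n _ ih => exact ih.append_nil (h n)
  -- Invariant: the current state can still silently rejoin the sequence. The next genuine
  -- transition is the first one on the way to a later `y`, or `y → z` itself if that way is empty.
  obtain ⟨f, h₀, -, h₁⟩ := exists_seq_of_step (Q := fun _ q => ∃ n, L.Weak q [] (t n))
    (R := fun _ q r => L.Tr q none r) ⟨0, Weak.refl (t 0)⟩ (by
      rintro - q ⟨m, hq⟩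
      obtain ⟨n, hmn, y, z, hy, hyz, hz⟩ := h' m
      have hqy : L.Path q [] y :=
        weak_iff_path.1 ((hq.append_nil (mono m n hmn)).append_nil hy)
      cases hqy with
      | nil => exact ⟨z, ⟨_, hz⟩, hyz⟩
      | tau h₁ h₂ =>
        exact ⟨_, ⟨_, ((weak_iff_path.2 h₂).append_nil (.tau hyz)).append_nil hz⟩, h₁⟩)
  exact ⟨f, h₀, h₁⟩

end Divergence

section InfTraces

theorem mem_infTraces_cons {p : L.State} {a : Act} {s : Stream' Act} :
    Stream'.cons a s ∈ L.infTraces p ↔ ∃ q, L.Weak p [a] q ∧ s ∈ L.infTraces q := by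
  constructor
  · rintro ⟨f, rfl, hf⟩
    exact ⟨f 1, hf 0, fun i => f (i + 1), rfl, fun i => hf (i + 1)⟩
  · rintro ⟨q, hq, f, rfl, hf⟩
    refine ⟨fun i => Nat.casesOn i p f, rfl, fun i => ?_⟩
    cases i with
    | zero => exact hq
    | succ i => exact hf i

theorem mem_infTraces_append {p : L.State} {l : List Act} {s : Stream' Act} :
    l ++ₛ s ∈ L.infTraces p ↔ ∃ q, L.Weak p l q ∧ s ∈ L.infTraces q := by
  induction l generalizing p with
  | nil =>
    refine ⟨fun h => ⟨p, .refl _, h⟩, ?_⟩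
    rintro ⟨q, hq, hs⟩
    rw [Stream'.nil_append_stream]
    rw [← Stream'.eta s, mem_infTraces_cons] at hs ⊢
    obtain ⟨r, hr, hs⟩ := hs
    exact ⟨r, hq.trans hr, hs⟩
  | cons a l ih =>
    rw [Stream'.cons_append_stream, mem_infTraces_cons]
    constructor
    · rintro ⟨q, hq, h⟩
      obtain ⟨r, hr, h⟩ := ih.1 h
      exact ⟨r, hq.trans hr, h⟩
    · rintro ⟨r, hr, h⟩
      obtain ⟨q, hq, hr⟩ := hr.split_cons
      exact ⟨q, hq, ih.2 ⟨r, hr, h⟩⟩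

/-- Weak steps with words of arbitrary length are regrouped into steps with one letter each. The
state carried along has a pending word `ρ` that leads back to some `s m`. -/
theorem mem_infTraces_of_weak {s : ℕ → L.State} {l : ℕ → List Act} {t : ℕ → Stream' Act}
    (h : ∀ n, L.Weak (s n) (l n) (s (n + 1))) (ht : ∀ n, t n = l n ++ₛ t (n + 1))
    (hl : ∀ N, ∃ n, N ≤ n ∧ l n ≠ []) : t 0 ∈ L.infTraces (s 0) := by
  have key : ∀ (p : L.State) (m : ℕ) (ρ : List Act), L.Weak p ρ (s m) →
      ∃ p' m' ρ', L.Weak p [(ρ ++ₛ t m).head] p' ∧ L.Weak p' ρ' (s m') ∧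
        (ρ ++ₛ t m).tail = ρ' ++ₛ t m' := by
    intro p m ρ hp
    have ext : ∀ n, m ≤ n → ∃ ν, L.Weak p ν (s n) ∧ ρ ++ₛ t m = ν ++ₛ t n := by
      intro n hmn
      induction n, hmn using Nat.le_induction with
      | base => exact ⟨ρ, hp, rfl⟩
      | succ n _ ih =>
        obtain ⟨ν, hν, he⟩ := ih
        exact ⟨ν ++ l n, hν.trans (h n), by rw [he, ht n, Stream'.append_append_stream]⟩
    -- The pending word may be empty; it is prolonged past a nonempty `l n` so that a head can be
    -- split off.
    obtain ⟨n, hmn, hn⟩ := hl m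
    obtain ⟨ν, hν, he⟩ := ext n hmn
    have hne : ν ++ l n ≠ [] := by simp [hn]
    have hν' := hν.trans (h n)
    rw [ht n, ← Stream'.append_append_stream] at he
    rw [he]
    generalize ν ++ l n = κ at hne hν'
    cases κ with
    | nil => exact absurd rfl hne
    | cons a κ =>
      obtain ⟨p', h₁, h₂⟩ := hν'.split_cons
      exact ⟨p', n + 1, κ, h₁, h₂, rfl⟩
  obtain ⟨f, hf₀, -, hf⟩ := exists_seq_of_step (X := L.State)
    (Q := fun i p => ∃ m ρ, L.Weak p ρ (s m) ∧ (t 0).drop i = ρ ++ₛ t m)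
    (R := fun i p p' => L.Weak p [(t 0).get i] p') (x₀ := s 0)
    ⟨0, [], .refl _, rfl⟩ (by
      rintro i p ⟨m, ρ, hp, he⟩
      obtain ⟨p', m', ρ', h₁, h₂, h₃⟩ := key p m ρ hp
      rw [← he, Stream'.head_drop] at h₁
      rw [← he, Stream'.tail_drop'] at h₃
      exact ⟨p', ⟨m', ρ', h₂, h₃⟩, h₁⟩)
  exact ⟨f, hf₀, hf⟩

end InfTraces

/-! ### The flooded preorder: replaying weak computations, and liveness. -/

section Flooding

theorem mem_divergencesBot_of_mem {p : L.State} {σ : List Act} (h : σ ∈ L.divergences p) :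
    σ ∈ L.divergencesBot p :=
  ⟨σ, h, [], by simp⟩

theorem divergencesBot_append {p : L.State} {σ : List Act} (h : σ ∈ L.divergencesBot p)
    (ρ : List Act) : σ ++ ρ ∈ L.divergencesBot p := by
  obtain ⟨ν, hν, κ, rfl⟩ := h
  exact ⟨ν, hν, κ ++ ρ, by simp⟩

theorem divergencesBot_of_prefix {p : L.State} {σ ρ : List Act} (h : σ ∈ L.divergencesBot p)
    (hρ : σ <+: ρ) : ρ ∈ L.divergencesBot p := by
  obtain ⟨ν, rfl⟩ := hρ
  exact divergencesBot_append h ν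

theorem infBot_of_divergencesBot {p : L.State} {σ : List Act} (h : σ ∈ L.divergencesBot p)
    (s : Stream' Act) : σ ++ₛ s ∈ L.infBot p := by
  obtain ⟨ν, hν, κ, rfl⟩ := h
  exact Or.inr ⟨ν, hν, κ ++ₛ s, by rw [Stream'.append_append_stream]⟩

theorem failuresBot_of_divergencesBot {p : L.State} {σ : List Act}
    (h : σ ∈ L.divergencesBot p) (X : Set Act) : (σ, X) ∈ L.failuresBot p := by
  obtain ⟨ν, hν, κ, rfl⟩ := h
  exact Or.inr ⟨ν, hν, κ, X, rfl⟩

theorem mem_failuresBot_iff {p : L.State} {σ : List Act} {X : Set Act} :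
    (σ, X) ∈ L.failuresBot p ↔ (σ, X) ∈ L.failures p ∨ σ ∈ L.divergencesBot p := by
  refine ⟨?_, fun h => h.elim Or.inl fun h => failuresBot_of_divergencesBot h X⟩
  rintro (h | ⟨ν, hν, κ, Y, h⟩)
  · exact Or.inl h
  · exact Or.inr ⟨ν, hν, κ, (Prod.mk.inj h).1⟩

theorem mem_failures_iff {p : L.State} {σ : List Act} {X : Set Act} :
    (σ, X) ∈ L.failures p ↔ ∃ q, L.Weak p σ q ∧ (∀ r, ¬ L.Tr q none r) ∧
      ∀ a ∈ X, ∀ r, ¬ L.Tr q (some a) r := by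
  simp only [failures, initials, Set.mem_ofPred_eq, Set.eq_empty_iff_forall_notMem]
  refine exists_congr fun q => and_congr_right fun _ => ⟨fun h => ⟨fun r hr => ?_,
    fun a ha r hr => ?_⟩, ?_⟩
  · exact h none ⟨⟨r, hr⟩, Or.inr rfl⟩
  · exact h (some a) ⟨⟨r, hr⟩, Or.inl ⟨a, ha, rfl⟩⟩
  · rintro ⟨h₁, h₂⟩ α ⟨⟨r, hr⟩, ⟨a, ha, rfl⟩ | rfl⟩
    · exact h₂ a ha r hr
    · exact h₁ r hr

namespace FDIBot

variable {p q : L.State}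

theorem refl (p : L.State) : L.FDIBot p p := ⟨subset_rfl, subset_rfl, subset_rfl⟩

theorem trans {r : L.State} (h : L.FDIBot p q) (h' : L.FDIBot q r) : L.FDIBot p r :=
  ⟨h'.1.trans h.1, h'.2.1.trans h.2.1, h'.2.2.trans h.2.2⟩

theorem of_divergences (h : L.FDIBot p q) {σ : List Act} (hσ : σ ∈ L.divergences q) :
    σ ∈ L.divergencesBot p :=
  h.1 (mem_divergencesBot_of_mem hσ)

theorem of_failures (h : L.FDIBot p q) {σ : List Act} {X : Set Act} (hσ : (σ, X) ∈ L.failures q) :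
    (σ, X) ∈ L.failures p ∨ σ ∈ L.divergencesBot p :=
  mem_failuresBot_iff.1 (h.2.2 (Or.inl hσ))

/-- Traces are not compared directly: either `q'` diverges, or it silently reaches a stable state
and `σ` is a failure with empty refusal set. -/
theorem of_weak (h : L.FDIBot p q) {q' : L.State} {σ : List Act} (hσ : L.Weak q σ q') :
    σ ∈ L.divergencesBot p ∨ ∃ p', L.Weak p σ p' := by
  by_cases hd : L.Diverges q'
  · exact Or.inl (h.of_divergences ⟨q', hσ, hd⟩)
  · obtain ⟨r, hr, hs⟩ := exists_stable_of_not_diverges hd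
    have : (σ, ∅) ∈ L.failures q := mem_failures_iff.2 ⟨r, hσ.append_nil hr, hs, by simp⟩
    rcases h.of_failures this with hf | hf
    · obtain ⟨p', hp', -⟩ := mem_failures_iff.1 hf
      exact Or.inr ⟨p', hp'⟩
    · exact Or.inl hf

/-- An infinite sequence of weak steps of `q` can be copied by `p`, unless `p` has a flooded
divergence along it. -/
theorem exists_replay (h : L.FDIBot p q) {s : ℕ → L.State} {l : ℕ → List Act} (hs₀ : s 0 = q)
    (hs : ∀ n, L.Weak (s n) (l n) (s (n + 1))) :
    (∃ n, concatUpTo l n ∈ L.divergencesBot p) ∨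
      ∃ f : ℕ → L.State, f 0 = p ∧ ∀ n, L.Weak (f n) (l n) (f (n + 1)) := by
  subst hs₀
  by_cases hl : ∀ N, ∃ n, N ≤ n ∧ l n ≠ []
  · obtain ⟨t, ht⟩ := exists_stream_concat hl
    rcases h.2.1 (Or.inl (mem_infTraces_of_weak hs ht hl)) with hp | ⟨σ, hσ, ν, he⟩
    · right
      obtain ⟨f, hf₀, -, hf⟩ := exists_seq_of_step (Q := fun n y => t n ∈ L.infTraces y)
        (R := fun n y z => L.Weak y (l n) z) hp fun n y hy => by
          rw [ht n, mem_infTraces_append] at hy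
          obtain ⟨z, hz, hz'⟩ := hy
          exact ⟨z, hz', hz⟩
      exact ⟨f, hf₀, hf⟩
    · left
      -- The divergence `σ` of `p` lies on the stream, so it is a prefix of every partial
      -- concatenation longer than itself.
      obtain ⟨n, hn⟩ := exists_lt_length_concatUpTo hl σ.length
      rw [← concatUpTo_append_stream ht n] at he
      exact ⟨n, divergencesBot_of_prefix (mem_divergencesBot_of_mem hσ)
        (List.prefix_of_append_stream_eq he.symm hn.le)⟩
  -- From some `N` on all words are empty, so one finite trace has to be copied; `r n` is the part
  -- of it still to be performed at stage `n`.
  · push Not at hl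
    obtain ⟨N, hN⟩ := hl
    have hpre : ∀ n, concatUpTo l n <+: concatUpTo l N := by
      intro n
      rcases le_total n N with hn | hn
      · exact concatUpTo_prefix l hn
      · induction n, hn using Nat.le_induction with
        | base => exact List.prefix_rfl
        | succ n hn ih => rwa [concatUpTo, hN n hn, List.append_nil]
    choose r hr using hpre
    have hr' : ∀ n, r n = l n ++ r (n + 1) := by
      intro n
      have := (hr n).trans (hr (n + 1)).symm
      rwa [concatUpTo, List.append_assoc, List.append_cancel_left_eq] at this
    rcases h.of_weak (Weak.concat hs N) with hd | ⟨p', hp'⟩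
    · exact Or.inl ⟨N, hd⟩
    · right
      have h₀ : r 0 = concatUpTo l N := by simpa [concatUpTo] using hr 0
      obtain ⟨f, hf₀, -, hf⟩ := exists_seq_of_step (Q := fun n y => L.Weak y (r n) p')
        (R := fun n y z => L.Weak y (l n) z) (x₀ := p) (h₀ ▸ hp') fun n y hy => by
          rw [hr' n] at hy
          obtain ⟨z, hz, hz'⟩ := hy.split
          exact ⟨z, hz', hz⟩
      exact ⟨f, hf₀, hf⟩

/-- The flooded preorder respects all liveness properties. -/
theorem satisfiesLiveness (h : L.FDIBot p q) {G : Set (List Act)}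
    (hp : L.SatisfiesLiveness p G) : L.SatisfiesLiveness q G := by
  have hdiv : ∀ σ ∈ L.divergences p, ∃ ρ ∈ G, ∃ ν, ρ ++ ν = σ := fun σ hσ =>
    hp (Sum.inl σ) (Or.inl (Or.inr ⟨σ, hσ, rfl⟩))
  have hbot : ∀ σ ∈ L.divergencesBot p, ∃ ρ ∈ G, ∃ ν, ρ ++ ν = σ := by
    rintro - ⟨σ, hσ, κ, rfl⟩
    obtain ⟨ρ, hρ, ν, rfl⟩ := hdiv σ hσ
    exact ⟨ρ, hρ, ν ++ κ, by simp⟩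
  rintro - ((⟨s, hs, rfl⟩ | ⟨σ, hσ, rfl⟩) | ⟨σ, ⟨r, hr, hd⟩, rfl⟩)
  · rcases h.2.1 (Or.inl hs) with hs | ⟨σ, hσ, ν, rfl⟩
    · exact hp (Sum.inr s) (Or.inl (Or.inl ⟨s, hs, rfl⟩))
    · obtain ⟨ρ, hρ, κ, rfl⟩ := hdiv σ hσ
      exact ⟨ρ, hρ, κ ++ₛ ν, by rw [Stream'.append_append_stream]⟩
  · exact hbot σ (h.of_divergences hσ)
  -- A deadlock is a failure that refuses every visible action.
  · have : (σ, Set.univ) ∈ L.failures q :=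
      mem_failures_iff.2 ⟨r, hr, fun _ => hd _ _, fun _ _ _ => hd _ _⟩
    rcases h.of_failures this with hf | hf
    · obtain ⟨p', hp', h₁, h₂⟩ := mem_failures_iff.1 hf
      refine hp (Sum.inl σ) (Or.inr ⟨σ, ⟨p', hp', ?_⟩, rfl⟩)
      rintro (_ | a) t ht
      · exact h₁ t ht
      · exact h₂ a trivial t ht
    · exact hbot σ hf

end FDIBot

end Flooding

end LTS

/-! ### Processes under the control of a transducer. -/

namespace LTS

variable {Act : Type u} {L : LTS.{u, w} Act} {K : Type y}

/-- A control with states in `K` that reads the visible actions of a process: `idle k α k'` is a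
move of the control alone, and `act k a α k'` is a move in which the process performs `a`; both
show up as `α`. -/
structure Transducer (Act : Type u) (K : Type y) where
  idle : K → Option Act → K → Prop
  act : K → Act → Option Act → K → Prop

namespace Transducer

variable {T : Transducer Act K}

/-- `F k p` behaves as the process `p` under the control `T` in state `k`. -/
def Realizes (T : Transducer Act K) (F : K → L.State → L.State) : Prop :=
  ∀ k p α t, L.Tr (F k p) α t ↔
    (∃ k', T.idle k α k' ∧ t = F k' p) ∨
    (∃ a k' p', T.act k a α k' ∧ L.Tr p (some a) p' ∧ t = F k' p') ∨
    (α = none ∧ ∃ p', L.Tr p none p' ∧ t = F k p')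

variable (T) in
/-- `T.Run k i o k'`: the control moves from `k` to `k'` while reading `i` and showing `o`. -/
inductive Run : K → List Act → List Act → K → Prop
  | refl (k : K) : Run k [] [] k
  | idle {k k' k'' : K} {α : Option Act} {i o : List Act} :
      T.idle k α k' → Run k' i o k'' → Run k i (α.toList ++ o) k''
  | act {k k' k'' : K} {a : Act} {α : Option Act} {i o : List Act} :
      T.act k a α k' → Run k' i o k'' → Run k (a :: i) (α.toList ++ o) k''

theorem Run.trans {k k' k'' : K} {i i' o o' : List Act} (h : T.Run k i o k')
    (h' : T.Run k' i' o' k'') : T.Run k (i ++ i') (o ++ o') k'' := by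
  induction h with
  | refl => exact h'
  | idle h _ ih => rw [List.append_assoc]; exact .idle h (ih h')
  | act h _ ih => rw [List.append_assoc]; exact .act h (ih h')

theorem Run.split {k k' : K} {i i' o : List Act} (h : T.Run k (i ++ i') o k') :
    ∃ o₁ o₂ k₁, o = o₁ ++ o₂ ∧ T.Run k i o₁ k₁ := by
  generalize hj : i ++ i' = j at h
  induction h generalizing i with
  | refl k =>
    obtain ⟨rfl, -⟩ := List.append_eq_nil_iff.1 hj
    exact ⟨[], [], k, rfl, .refl k⟩
  | idle h _ ih =>
    obtain ⟨o₁, o₂, k₁, rfl, hr⟩ := ih hj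
    exact ⟨_, o₂, k₁, (List.append_assoc _ _ _).symm, .idle h hr⟩
  | @act k _ _ _ α _ o h _ ih =>
    cases i with
    | nil => exact ⟨[], α.toList ++ o, k, rfl, .refl k⟩
    | cons b i =>
      rw [List.cons_append] at hj
      obtain ⟨rfl, hj'⟩ := List.cons.inj hj
      obtain ⟨o₁, o₂, k₁, rfl, hr⟩ := ih hj'
      exact ⟨_, o₂, k₁, (List.append_assoc _ _ _).symm, .act h hr⟩

theorem Run.concat {k : ℕ → K} {i o : ℕ → List Act}
    (h : ∀ n, T.Run (k n) (i n) (o n) (k (n + 1))) (n : ℕ) :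
    T.Run (k 0) (concatUpTo i n) (concatUpTo o n) (k n) := by
  induction n with
  | zero => exact .refl _
  | succ n ih => exact ih.trans (h n)

namespace Realizes

variable {F : K → L.State → L.State} {p q : L.State} {k : K}

theorem tau (hF : T.Realizes F) {p' : L.State} (h : L.Tr p none p') :
    L.Tr (F k p) none (F k p') :=
  (hF _ _ _ _).2 (Or.inr (Or.inr ⟨rfl, p', h, rfl⟩))

theorem idle (hF : T.Realizes F) {k' : K} {α : Option Act} (h : T.idle k α k') :
    L.Tr (F k p) α (F k' p) :=
  (hF _ _ _ _).2 (Or.inl ⟨k', h, rfl⟩)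

theorem act (hF : T.Realizes F) {k' : K} {p' : L.State} {a : Act} {α : Option Act}
    (h : T.act k a α k') (hp : L.Tr p (some a) p') : L.Tr (F k p) α (F k' p') :=
  (hF _ _ _ _).2 (Or.inr (Or.inl ⟨a, k', p', h, hp, rfl⟩))

theorem weak_nil (hF : T.Realizes F) {p' : L.State} (h : L.Weak p [] p') :
    L.Weak (F k p) [] (F k p') := by
  rw [weak_iff_path] at h
  generalize hi : ([] : List Act) = i at h
  induction h with
  | nil => exact .refl _
  | tau h _ ih => exact (ih hi).cons_tau (hF.tau h)
  | act => simp at hi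

theorem weak_of_tr {p p' r : L.State} {α : Option Act} {o : List Act} (h : L.Tr p α p')
    (hw : L.Weak p' o r) : L.Weak p (α.toList ++ o) r := by
  cases α with
  | none => exact hw.cons_tau h
  | some a => exact hw.cons_act h

theorem weak (hF : T.Realizes F) {k' : K} {p' : L.State} {i o : List Act} (hr : T.Run k i o k')
    (h : L.Weak p i p') : L.Weak (F k p) o (F k' p') := by
  induction hr generalizing p with
  | refl => exact hF.weak_nil h
  | idle hi _ ih => exact weak_of_tr (hF.idle hi) (ih h)
  | act ha _ ih =>
    obtain ⟨p₁, p₂, h₁, h₂, h₃⟩ := h.exists_act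
    exact (hF.weak_nil h₁).trans (weak_of_tr (hF.act ha h₂) (ih h₃))

theorem exists_of_weak (hF : T.Realizes F) {o : List Act} {t : L.State}
    (h : L.Weak (F k p) o t) :
    ∃ i k' p', T.Run k i o k' ∧ L.Weak p i p' ∧ t = F k' p' := by
  rw [weak_iff_path] at h
  have step : ∀ {k p α s o t}, L.Tr (F k p) α s → (∀ k p, s = F k p →
      ∃ i k' p', T.Run k i o k' ∧ L.Weak p i p' ∧ t = F k' p') →
      ∃ i k' p', T.Run k i (α.toList ++ o) k' ∧ L.Weak p i p' ∧ t = F k' p' := by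
    intro k p α s o t hs ih
    rcases (hF _ _ _ _).1 hs with ⟨k₁, h₁, he⟩ | ⟨a, k₁, p₁, h₁, h₂, he⟩ | ⟨rfl, p₁, h₁, he⟩
    · obtain ⟨i, k', p', hr, hw, ht⟩ := ih _ _ he
      exact ⟨i, k', p', .idle h₁ hr, hw, ht⟩
    · obtain ⟨i, k', p', hr, hw, ht⟩ := ih _ _ he
      exact ⟨a :: i, k', p', .act h₁ hr, hw.cons_act h₂, ht⟩
    · obtain ⟨i, k', p', hr, hw, ht⟩ := ih _ _ he
      exact ⟨i, k', p', hr, hw.cons_tau h₁, ht⟩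
  generalize hs : F k p = s at h
  induction h generalizing k p with
  | nil => exact ⟨[], k, p, .refl k, .refl p, hs.symm⟩
  | tau h _ ih =>
    subst hs
    exact step h fun k p he => ih he.symm
  | act h _ ih =>
    subst hs
    exact step h fun k p he => ih he.symm

theorem diverges (hF : T.Realizes F) (h : L.Diverges p) : L.Diverges (F k p) := by
  obtain ⟨f, rfl, hf⟩ := h
  exact ⟨fun n => F k (f n), rfl, fun n => hF.tau (hf n)⟩

/-- The process already diverges after some prefix of `i`. By then the control has shown a prefix of
`o`, and flooding supplies the remainder. -/
theorem divergencesBot_of_run (hF : T.Realizes F) {k' : K} {i o : List Act}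
    (hr : T.Run k i o k') (hi : i ∈ L.divergencesBot p) : o ∈ L.divergencesBot (F k p) := by
  obtain ⟨σ, ⟨r, hw, hd⟩, ρ, rfl⟩ := hi
  obtain ⟨o₁, o₂, k₁, rfl, hr'⟩ := hr.split
  exact ⟨o₁, ⟨F k₁ r, hF.weak hr' hw, hF.diverges hd⟩, o₂, rfl⟩

theorem infTraces_subset (hF : T.Realizes F) (h : L.FDIBot p q) :
    L.infTraces (F k q) ⊆ L.infBot (F k p) := by
  rintro t ⟨s, hs₀, hs⟩
  obtain ⟨f, hf₀, -, hf⟩ := exists_seq_of_step (X := K × L.State)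
    (Q := fun n y => s n = F y.1 y.2)
    (R := fun n y z => ∃ i, T.Run y.1 i [t.get n] z.1 ∧ L.Weak y.2 i z.2) (x₀ := (k, q)) hs₀ (by
      rintro n ⟨k₁, q₁⟩ he
      have := hs n
      rw [he] at this
      obtain ⟨i, k₂, q₂, hr, hw, he'⟩ := hF.exists_of_weak this
      exact ⟨(k₂, q₂), he', i, hr, hw⟩)
  choose i hi hw using hf
  rcases h.exists_replay (s := fun n => (f n).2) (by rw [hf₀]) hw with ⟨n, hn⟩ | ⟨r, hr₀, hr⟩
  · have hrun := Run.concat hi n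
    rw [hf₀, concatUpTo_singleton] at hrun
    rw [← Stream'.append_take_drop n t]
    exact infBot_of_divergencesBot (hF.divergencesBot_of_run hrun hn) _
  · exact Or.inl ⟨fun n => F (f n).1 (r n), by simp only [hf₀, hr₀], fun n => hF.weak (hi n) (hr n)⟩

/-- A divergence of the composition may consist of concealed visible actions of `q`, so the
divergences of `q` do not suffice here: infinite traces enter through the replay. -/
theorem divergences_subset (hF : T.Realizes F) (h : L.FDIBot p q) :
    L.divergences (F k q) ⊆ L.divergencesBot (F k p) := by
  rintro o ⟨t, ht, s, hs₀, hs⟩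
  obtain ⟨i₀, k₀, q₀, hr₀, hw₀, rfl⟩ := hF.exists_of_weak ht
  obtain ⟨f, hf₀, -, hf⟩ := exists_seq_of_step (X := K × L.State)
    (Q := fun n y => s n = F y.1 y.2)
    (R := fun n y z => ∃ i, T.Run y.1 i [] z.1 ∧ L.Weak y.2 i z.2 ∧
      ((∃ a, i = [a] ∧ T.act y.1 a none z.1) ∨ (i = [] ∧ T.idle y.1 none z.1) ∨
        (i = [] ∧ L.Tr y.2 none z.2))) (x₀ := (k₀, q₀)) hs₀ (by
      rintro n ⟨k₁, q₁⟩ he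
      have := hs n
      rw [he] at this
      rcases (hF _ _ _ _).1 this with ⟨k₂, h₁, he⟩ | ⟨a, k₂, q₂, h₁, h₂, he⟩ | ⟨-, q₂, h₁, he⟩
      · exact ⟨(k₂, q₁), he, [], .idle h₁ (.refl _), .refl _, Or.inr (Or.inl ⟨rfl, h₁⟩)⟩
      · exact ⟨(k₂, q₂), he, [a], .act h₁ (.refl _), .act h₂, Or.inl ⟨a, rfl, h₁⟩⟩
      · exact ⟨(k₁, q₂), he, [], .refl _, .tau h₁, Or.inr (Or.inr ⟨rfl, h₁⟩)⟩)
  choose i hi hw hc using hf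
  -- The computation that shows `o` is prepended as step 0, so that a single replay from `p` covers
  -- both it and the divergence.
  let k' : ℕ → K := fun n => Nat.casesOn n k fun n => (f n).1
  let q' : ℕ → L.State := fun n => Nat.casesOn n q fun n => (f n).2
  let i' : ℕ → List Act := fun n => Nat.casesOn n i₀ i
  let o' : ℕ → List Act := fun n => Nat.casesOn n o fun _ => []
  have hrun : ∀ n, T.Run (k' n) (i' n) (o' n) (k' (n + 1)) := by
    rintro (_ | n)
    · change T.Run k i₀ o (f 0).1
      rwa [hf₀]
    · exact hi n
  have hweak : ∀ n, L.Weak (q' n) (i' n) (q' (n + 1)) := by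
    rintro (_ | n)
    · change L.Weak q i₀ (f 0).2
      rwa [hf₀]
    · exact hw n
  have ho : ∀ n, concatUpTo o' (n + 1) = o := by
    intro n
    induction n with
    | zero => rfl
    | succ n ih => rw [concatUpTo, ih]; exact List.append_nil o
  have hfin : ∀ n, concatUpTo i' n ∈ L.divergencesBot p → o ∈ L.divergencesBot (F k p) := by
    intro n hn
    have := hF.divergencesBot_of_run (Run.concat hrun n) hn
    cases n with
    | zero => exact divergencesBot_of_prefix this List.nil_prefix
    | succ n => rwa [ho] at this
  -- If infinitely many steps involve the control, each of them yields a genuine silent transition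
  -- in the replay. Otherwise `q` itself ends up diverging.
  by_cases hmove : ∀ N, ∃ n, N ≤ n ∧ ¬ (i n = [] ∧ L.Tr (f n).2 none (f (n + 1)).2)
  · rcases h.exists_replay (s := q') rfl hweak with ⟨n, hn⟩ | ⟨r, hr₀, hr⟩
    · exact hfin n hn
    · refine mem_divergencesBot_of_mem ⟨F (f 0).1 (r 1), ?_, ?_⟩
      · have := hF.weak (hrun 0) (hr 0)
        rwa [hr₀] at this
      · refine diverges_of_weak (t := fun n => F (f n).1 (r (n + 1)))
          (fun n => hF.weak (hi n) (hr (n + 1))) fun N => ?_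
        obtain ⟨n, hNn, hn⟩ := hmove N
        have hrn : L.Weak (r (n + 1)) (i n) (r (n + 1 + 1)) := hr (n + 1)
        refine ⟨n, hNn, ?_⟩
        rcases hc n with ⟨a, ha, hact⟩ | ⟨ha, hidle⟩ | hn'
        · rw [ha] at hrn
          obtain ⟨r₁, r₂, h₁, h₂, h₃⟩ := hrn.exists_act
          exact ⟨_, _, hF.weak_nil h₁, hF.act hact h₂, hF.weak_nil h₃⟩
        · rw [ha] at hrn
          exact ⟨_, _, .refl _, hF.idle hidle, hF.weak_nil hrn⟩
        · exact absurd hn' hn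
  · push Not at hmove
    obtain ⟨N, hN⟩ := hmove
    refine hfin (N + 1) (h.of_divergences ⟨(f N).2, Weak.concat hweak (N + 1), ?_⟩)
    exact ⟨fun n => (f (N + n)).2, rfl, fun n => (hN (N + n) (by omega)).2⟩

theorem failures_subset (hF : T.Realizes F) (h : L.FDIBot p q) :
    L.failures (F k q) ⊆ L.failuresBot (F k p) := by
  rintro ⟨o, X⟩ hX
  obtain ⟨t, ht, h₁, h₂⟩ := mem_failures_iff.1 hX
  obtain ⟨i, k', q', hr, hw, rfl⟩ := hF.exists_of_weak ht
  -- With the maximal refusal set of `q'`, the matching stable `p'` enables only visible actions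
  -- that `q'` enables, so the same control offers no more with `p'` than with `q'`.
  have : (i, {a | ∀ r, ¬ L.Tr q' (some a) r}) ∈ L.failures q :=
    mem_failures_iff.2 ⟨q', hw, fun r hr => h₁ _ (hF.tau hr), fun a ha => ha⟩
  rw [mem_failuresBot_iff]
  rcases h.of_failures this with hp | hp
  · left
    obtain ⟨p', hp', hst, href⟩ := mem_failures_iff.1 hp
    have himp : ∀ α r, L.Tr (F k' p') α r → ∃ r', L.Tr (F k' q') α r' := by
      intro α r hr
      rcases (hF _ _ _ _).1 hr with ⟨k₂, h₁, -⟩ | ⟨a, k₂, p₂, h₁, h₂, -⟩ | ⟨-, p₂, h₁, -⟩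
      · exact ⟨_, hF.idle h₁⟩
      · by_contra! hn
        exact href a (fun r hr => hn _ (hF.act h₁ hr)) _ h₂
      · exact absurd h₁ (hst _)
    refine mem_failures_iff.2 ⟨F k' p', hF.weak hr hp', fun r hr => ?_, fun a ha r hr => ?_⟩
    · obtain ⟨r', hr'⟩ := himp _ _ hr
      exact h₁ r' hr'
    · obtain ⟨r', hr'⟩ := himp _ _ hr
      exact h₂ a ha r' hr'
  · exact Or.inr (hF.divergencesBot_of_run hr hp)

/-- Control by a transducer preserves the flooded preorder. -/
theorem fdiBot (hF : T.Realizes F) (h : L.FDIBot p q) (k : K) : L.FDIBot (F k p) (F k q) := by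
  refine ⟨?_, ?_, ?_⟩
  · rintro - ⟨σ, hσ, ρ, rfl⟩
    exact divergencesBot_append (hF.divergences_subset h hσ) ρ
  · rintro s (hs | ⟨σ, hσ, ρ, rfl⟩)
    · exact hF.infTraces_subset h hs
    · exact infBot_of_divergencesBot (hF.divergences_subset h hσ) ρ
  · rintro φ (hφ | ⟨σ, hσ, ρ, X, rfl⟩)
    · exact hF.failures_subset h hφ
    · exact failuresBot_of_divergencesBot
        (divergencesBot_append (hF.divergences_subset h hσ) ρ) X

end Realizes

end Transducer

/-! ### The operators as transducers. -/

section Precongruence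

variable (ops : Operators.{u, w, x} L)

/-- The other component serves as the state of the control: it moves alone outside `S`, and reading
an action in `S` moves it along. -/
theorem Operators.par_left_realizes (S : Set Act) :
    Transducer.Realizes (L := L)
      ⟨fun r α r' => L.Tr r α r' ∧ α ∉ some '' S,
        fun r a α r' => α = some a ∧ ((a ∉ S ∧ r' = r) ∨ (a ∈ S ∧ L.Tr r (some a) r'))⟩
      (fun r p => ops.par S p r) := by
  intro r p α t
  rw [ops.par_iff]
  constructor
  · rintro (⟨hp, hα⟩ | ⟨hr, hα⟩ | ⟨hp, hr, ha⟩)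
    · cases α with
      | none => exact Or.inr (Or.inr ⟨rfl, _, hp, rfl⟩)
      | some a =>
        exact Or.inr (Or.inl ⟨a, r, _, ⟨rfl, Or.inl ⟨fun h => hα ⟨a, h, rfl⟩, rfl⟩⟩, hp, rfl⟩)
    · exact Or.inl ⟨_, ⟨hr, hα⟩, rfl⟩
    · exact Or.inr (Or.inl ⟨_, _, _, ⟨rfl, Or.inr ⟨ha, hr⟩⟩, hp, rfl⟩)
  · rintro (⟨r', ⟨hr, hα⟩, rfl⟩ | ⟨a, r', p', ⟨rfl, ⟨ha, rfl⟩ | ⟨ha, hr⟩⟩, hp, rfl⟩ |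
      ⟨rfl, p', hp, rfl⟩)
    · exact .right hr hα
    · exact .left hp (by simpa using ha)
    · exact .sync hp hr ha
    · exact .left hp (by simp)

theorem Operators.par_right_realizes (S : Set Act) :
    Transducer.Realizes (L := L)
      ⟨fun r α r' => L.Tr r α r' ∧ α ∉ some '' S,
        fun r a α r' => α = some a ∧ ((a ∉ S ∧ r' = r) ∨ (a ∈ S ∧ L.Tr r (some a) r'))⟩
      (fun r p => ops.par S r p) := by
  intro r p α t
  rw [ops.par_iff]
  constructor
  · rintro (⟨hr, hα⟩ | ⟨hp, hα⟩ | ⟨hr, hp, ha⟩)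
    · exact Or.inl ⟨_, ⟨hr, hα⟩, rfl⟩
    · cases α with
      | none => exact Or.inr (Or.inr ⟨rfl, _, hp, rfl⟩)
      | some a =>
        exact Or.inr (Or.inl ⟨a, r, _, ⟨rfl, Or.inl ⟨fun h => hα ⟨a, h, rfl⟩, rfl⟩⟩, hp, rfl⟩)
    · exact Or.inr (Or.inl ⟨_, _, _, ⟨rfl, Or.inr ⟨ha, hr⟩⟩, hp, rfl⟩)
  · rintro (⟨r', ⟨hr, hα⟩, rfl⟩ | ⟨a, r', p', ⟨rfl, ⟨ha, rfl⟩ | ⟨ha, hr⟩⟩, hp, rfl⟩ |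
      ⟨rfl, p', hp, rfl⟩)
    · exact .left hr hα
    · exact .right hp (by simpa using ha)
    · exact .sync hr hp ha
    · exact .right hp (by simp)

theorem Operators.hide_realizes (I : Set Act) :
    Transducer.Realizes (L := L)
      ⟨fun (_ : Unit) _ _ => False, fun _ a α _ => (a ∉ I ∧ α = some a) ∨ (a ∈ I ∧ α = none)⟩
      (fun _ p => ops.hide I p) := by
  intro k p α t
  rw [ops.hide_iff]
  constructor
  · rintro (⟨hp, hα⟩ | ⟨hp, ha⟩)
    · cases α with
      | none => exact Or.inr (Or.inr ⟨rfl, _, hp, rfl⟩)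
      | some a =>
        exact Or.inr (Or.inl ⟨a, k, _, Or.inl ⟨fun h => hα ⟨a, h, rfl⟩, rfl⟩, hp, rfl⟩)
    · exact Or.inr (Or.inl ⟨_, k, _, Or.inr ⟨ha, rfl⟩, hp, rfl⟩)
  · rintro (⟨_, h, -⟩ | ⟨a, k', p', ⟨ha, rfl⟩ | ⟨ha, rfl⟩, hp, rfl⟩ | ⟨rfl, p', hp, rfl⟩)
    · exact h.elim
    · exact .keep hp (by simpa using ha)
    · exact .conceal hp ha
    · exact .keep hp (by simp)

theorem Operators.lam_realizes (m : Interface.{u, x} Act) :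
    Transducer.Realizes (L := L)
      ⟨fun (_ : m.S) _ _ => False,
        fun s a α s' => α = some (m.action s a) ∧ s' = m.effect s a⟩
      (fun s p => ops.lam m s p) := by
  intro s p α t
  rw [ops.lam_iff]
  constructor
  · rintro (⟨hp⟩ | ⟨hp⟩)
    · exact Or.inr (Or.inr ⟨rfl, _, hp, rfl⟩)
    · exact Or.inr (Or.inl ⟨_, _, _, ⟨rfl, rfl⟩, hp, rfl⟩)
  · rintro (⟨_, h, -⟩ | ⟨a, s', p', ⟨rfl, rfl⟩, hp, rfl⟩ | ⟨rfl, p', hp, rfl⟩)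
    · exact h.elim
    · exact .visible hp
    · exact .silent hp

theorem FDIBot.isPrecongruence (O : Set (Oper.{u, x} Act)) :
    IsPrecongruence ops O L.FDIBot where
  refl := FDIBot.refl
  trans _ _ _ := FDIBot.trans
  closed C p q h := by
    induction C with
    | hole => exact h
    | parLeft S _ C r ih => exact (ops.par_left_realizes S).fdiBot ih r
    | parRight S _ r C ih => exact (ops.par_right_realizes S).fdiBot ih r
    | hide I _ C ih => exact (ops.hide_realizes I).fdiBot ih ()
    | lam m s _ C ih => exact (ops.lam_realizes m).fdiBot ih s

theorem FDIBot.respects_liveness : Respects L.FDIBot L.livenessProperties := by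
  rintro p q h - ⟨G, rfl⟩ hp
  exact h.satisfiesLiveness hp

end Precongruence

end LTS

/-! ### Tests for words. -/

theorem exists_injective_forall_ne {α : Type*} [Infinite α] (a : α) :
    ∃ f : α → α, Function.Injective f ∧ ∀ b, f b ≠ a := by
  -- Removing one point does not change an infinite cardinal; this is where infinitely many actions
  -- are needed.
  have h : Cardinal.mk α = Cardinal.mk ({a}ᶜ : Set α) := by
    simpa using (Cardinal.mk_compl_finset_of_infinite {a}).symm
  obtain ⟨e⟩ := Cardinal.eq.1 h
  exact ⟨fun b => e b, Subtype.val_injective.comp e.injective, fun b => (e b).2⟩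

theorem List.getElem_append_stream {α : Type*} {l : List α} {s t : Stream' α}
    (h : l ++ₛ s = t) {j : ℕ} {b : α} (hj : l[j]? = some b) : t.get j = b := by
  subst h
  induction l generalizing j with
  | nil => simp at hj
  | cons a l ih =>
    cases j with
    | zero => simpa using hj
    | succ j => exact ih (by simpa using hj)

namespace LTS

variable {Act : Type u} {L : LTS.{u, w} Act}

section Testing

/-- The transitions of a test for the word `w`, renamed by `f`: in state `some i` it performs the
`i`-th letter of the word or gives up with an action in `E i`. -/
def testTr (f : Act → Act) (w : ℕ → Option Act) (E : ℕ → Set Act) :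
    Option ℕ → Act → Option ℕ → Prop
  | some i, b, some j => j = i + 1 ∧ ∃ a, w i = some a ∧ b = f a
  | some i, b, none => b ∈ E i
  | none, _, _ => False

/-- The test as a labelled transition system. -/
def testLTS (f : Act → Act) (w : ℕ → Option Act) (E : ℕ → Set Act) : LTS.{u, v} Act where
  State := ULift.{v} (Option ℕ)
  Tr s α s' := ∃ b, α = some b ∧ testTr f w E s.down b s'.down

/-- The control of a process that is renamed by `f` and synchronises with the test on all actions
but `g`. -/
def testTransducer (g : Act) (f : Act → Act) (w : ℕ → Option Act) (E : ℕ → Set Act) :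
    Transducer Act (Option ℕ) where
  idle k α k' := α = some g ∧ testTr f w E k g k'
  act k a α k' := α = some (f a) ∧ testTr f w E k (f a) k'

/-- The words that deviate from `w`, renamed by `f`. -/
def deviating (f : Act → Act) (w : ℕ → Option Act) : Set (List Act) :=
  {o | ∃ (j : ℕ) (b : Act), o[j]? = some b ∧ ∀ a, w j = some a → b ≠ f a}

variable {g : Act} {f : Act → Act} {w' : ℕ → Option Act} {E : ℕ → Set Act}

/-- As `f` misses `g`, every visible action of the renamed process needs the test as a partner,
while `g` can only come from the test alone. -/
theorem Operators.test_realizes (ops : Operators.{u, w, x} L) (hg : ∀ a, f a ≠ g)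
    {e : ULift.{v} (Option ℕ) → L.State}
    (he : ∀ s α t, L.Tr (e s) α t ↔ ∃ s', t = e s' ∧ (testLTS.{u, v} f w' E).Tr s α s') :
    (testTransducer g f w' E).Realizes (L := L) fun k p =>
      ops.par {g}ᶜ (ops.lam (Interface.renaming f) PUnit.unit p) (e ⟨k⟩) := by
  intro k p α t
  rw [ops.par_iff]
  constructor
  · rintro (⟨hp, hα⟩ | ⟨hr, hα⟩ | ⟨hp, hr, ha⟩)
    · rcases (ops.lam_iff _ _ _ _ _).1 hp with ⟨hp'⟩ | ⟨hp'⟩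
      · exact Or.inr (Or.inr ⟨rfl, _, hp', rfl⟩)
      · exact absurd ⟨_, hg _, rfl⟩ hα
    · obtain ⟨⟨k'⟩, rfl, b, rfl, hb⟩ := (he _ _ _).1 hr
      obtain rfl : b = g := by
        by_contra hne
        exact hα ⟨b, hne, rfl⟩
      exact Or.inl ⟨k', ⟨rfl, hb⟩, rfl⟩
    · obtain ⟨⟨k'⟩, rfl, b, hb', hb⟩ := (he _ _ _).1 hr
      obtain rfl := Option.some.inj hb'
      generalize hβ : some _ = β at hp
      rcases (ops.lam_iff _ _ _ _ _).1 hp with ⟨hp'⟩ | ⟨hp'⟩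
      · simp at hβ
      · obtain rfl := Option.some.inj hβ
        exact Or.inr (Or.inl ⟨_, k', _, ⟨rfl, hb⟩, hp', rfl⟩)
  · rintro (⟨k', ⟨rfl, hk⟩, rfl⟩ | ⟨a, k', p', ⟨rfl, hk⟩, hp, rfl⟩ | ⟨rfl, p', hp, rfl⟩)
    · exact .right ((he _ _ _).2 ⟨⟨k'⟩, rfl, g, rfl, hk⟩) (by simp)
    · refine .sync ?_ ((he _ _ _).2 ⟨⟨k'⟩, rfl, f a, rfl, hk⟩) (hg a)
      exact (ops.lam_iff _ _ _ _ _).2 (.visible (m := Interface.renaming f) hp)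
    · exact .left ((ops.lam_iff _ _ _ _ _).2 (.silent hp)) (by simp)

theorem run_testTransducer {i : List Act} {m : ℕ} (hi : ∀ j < i.length, i[j]? = w' (m + j)) :
    (testTransducer g f w' E).Run (some m) i (i.map f) (some (m + i.length)) := by
  induction i generalizing m with
  | nil => exact .refl _
  | cons a i ih =>
    have h₀ : w' m = some a := by simpa using (hi 0 (by simp)).symm
    have := ih (m := m + 1) fun j hj => by
      rw [Nat.add_assoc, Nat.add_comm 1]
      simpa using hi (j + 1) (by simpa using hj)
    rw [Nat.add_assoc, Nat.add_comm 1] at this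
    exact .act (α := some (f a)) (k' := some (m + 1)) ⟨rfl, rfl, a, h₀, rfl⟩ this

/-- Giving up is visible, since `hE` makes every action in `E i` differ from the expected letter; as
long as the test goes on, injectivity of `f` identifies the letter read with that of the word. -/
theorem run_testTransducer_cases (hf : Function.Injective f) (hg : ∀ a, f a ≠ g)
    (hE : ∀ i, ∀ b ∈ E i, ∀ a, w' i = some a → b ≠ f a) {i o : List Act} {m : ℕ} {k : Option ℕ}
    (h : (testTransducer g f w' E).Run (some m) i o k) :
    (o = i.map f ∧ (∀ j < i.length, i[j]? = w' (m + j)) ∧ k = some (m + i.length)) ∨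
      ∃ (j : ℕ) (b : Act), o[j]? = some b ∧ ∀ a, w' (m + j) = some a → b ≠ f a := by
  generalize hk : some m = k₀ at h
  induction h generalizing m with
  | refl => exact Or.inl ⟨rfl, by simp, hk.symm⟩
  | @idle _ k' _ _ _ _ h _ ih =>
    subst hk
    obtain ⟨rfl, h⟩ := h
    cases k' with
    | none => exact Or.inr ⟨0, g, rfl, hE m g h⟩
    | some n =>
      obtain ⟨-, a, -, ha⟩ := h
      exact absurd ha.symm (hg a)
  | @act _ k' _ a _ i o h _ ih =>
    subst hk
    obtain ⟨rfl, h⟩ := h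
    cases k' with
    | none => exact Or.inr ⟨0, f a, rfl, hE m _ h⟩
    | some n =>
      obtain ⟨rfl, a', ha', haa⟩ := h
      obtain rfl := hf haa
      have hadd : ∀ j, m + (j + 1) = m + 1 + j := fun j => by omega
      rcases ih rfl with ⟨rfl, hi, rfl⟩ | ⟨j, b, hb, hj⟩
      · refine Or.inl ⟨rfl, ?_, congrArg some (hadd _).symm⟩
        rintro (_ | j) hj
        · simpa using ha'.symm
        · rw [hadd]
          simpa using hi j (by simpa using hj)
      · exact Or.inr ⟨j + 1, b, by simpa using hb, by rwa [hadd]⟩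

/-- The tested process fails to deviate from `w'` iff it has a complete trace along `w'`, where
deadlocks take the actions offered by the test into account. -/
theorem not_satisfiesLiveness_deviating_iff (hf : Function.Injective f) (hg : ∀ a, f a ≠ g)
    (hE : ∀ i, ∀ b ∈ E i, ∀ a, w' i = some a → b ≠ f a) {F : Option ℕ → L.State → L.State}
    (hF : (testTransducer g f w' E).Realizes F) {p : L.State} :
    ¬ L.SatisfiesLiveness (F (some 0) p) (deviating f w') ↔
      (∃ i, (∀ j < i.length, i[j]? = w' j) ∧ i ∈ L.divergences p) ∨
      (∃ s : Stream' Act, (∀ j, w' j = some (s.get j)) ∧ s ∈ L.infTraces p) ∨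
      (∃ i, (∀ j < i.length, i[j]? = w' j) ∧ ∃ p', L.Weak p i p' ∧
        L.Deadlocks (F (some i.length) p')) := by
  constructor
  · intro h
    simp only [SatisfiesLiveness] at h
    push Not at h
    have hfin : ∀ o t, L.Weak (F (some 0) p) o t →
        (∀ ρ ∈ deviating f w', ¬ IsPrefixOf ρ (Sum.inl o)) →
        ∃ i, (∀ j < i.length, i[j]? = w' j) ∧ ∃ p', L.Weak p i p' ∧ t = F (some i.length) p' := by
      intro o t ht ho
      obtain ⟨i, k, p', hr, hw, rfl⟩ := hF.exists_of_weak ht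
      rcases run_testTransducer_cases hf hg hE hr with ⟨rfl, hi, rfl⟩ | ⟨j, b, hb, hj⟩
      · exact ⟨i, by simpa using hi, p', hw, by simp⟩
      · exact absurd ⟨[], by simp⟩ (ho o ⟨j, b, hb, by simpa using hj⟩)
    obtain ⟨y, hy, hdev⟩ := h
    rcases hy with (⟨t, ⟨s, hs₀, hs⟩, rfl⟩ | ⟨o, ⟨t, ht, hd⟩, rfl⟩) | ⟨o, ⟨t, ht, hd⟩, rfl⟩
    · right; left
      obtain ⟨r, hr₀, -, hr⟩ := exists_seq_of_step (X := L.State)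
        (Q := fun n y => s n = F (some n) y)
        (R := fun n y z => ∃ a, w' n = some a ∧ L.Weak y [a] z) (x₀ := p) hs₀ (by
          intro n y hy
          have := hs n
          rw [hy] at this
          obtain ⟨i, k, z, hrun, hw, he⟩ := hF.exists_of_weak this
          rcases run_testTransducer_cases hf hg hE hrun with ⟨hi, hi', rfl⟩ | ⟨j, b, hb, hj⟩
          · obtain ⟨a, rfl, -⟩ := List.map_eq_singleton_iff.1 hi.symm
            exact ⟨z, he, a, by simpa using (hi' 0 (by simp)).symm, hw⟩
          · exfalso
            obtain ⟨rfl, rfl⟩ : j = 0 ∧ t.get n = b := by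
              cases j with
              | zero => simpa using hb
              | succ j => simp at hb
            exact hdev (t.take (n + 1)) ⟨n, t.get n, Stream'.getElem?_take (Nat.lt_succ_self n), hj⟩
              ⟨t.drop (n + 1), Stream'.append_take_drop _ _⟩)
      choose a ha hra using hr
      exact ⟨a, ha, r, hr₀, hra⟩
    · left
      obtain ⟨i, hi, p', hw, rfl⟩ := hfin o t ht hdev
      obtain ⟨s, hs₀, hs⟩ := hd
      obtain ⟨r, hr₀, -, hr⟩ := exists_seq_of_step (X := L.State)
        (Q := fun n y => s n = F (some i.length) y) (R := fun n y z => L.Tr y none z)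
        (x₀ := p') hs₀ (by
          intro n y hy
          have := hs n
          rw [hy] at this
          -- All moves of this control are visible, so the silent transitions belong to the process.
          rcases (hF _ _ _ _).1 this with ⟨_, ⟨h, -⟩, -⟩ | ⟨_, _, _, ⟨h, -⟩, -⟩ | ⟨-, z, hz, he⟩
          · simp at h
          · simp at h
          · exact ⟨z, he, hz⟩)
      exact ⟨i, hi, p', hw, r, hr₀, hr⟩
    · right; right
      obtain ⟨i, hi, p', hw, rfl⟩ := hfin o t ht hdev
      exact ⟨i, hi, p', hw, hd⟩
  · intro h hsat
    have hrun : ∀ {i : List Act}, (∀ j < i.length, i[j]? = w' j) → ∀ {p'}, L.Weak p i p' →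
        L.Weak (F (some 0) p) (i.map f) (F (some i.length) p') := by
      intro i hi p' hw
      have := run_testTransducer (g := g) (f := f) (E := E) (m := 0) (i := i) (by simpa using hi)
      rw [Nat.zero_add] at this
      exact hF.weak this hw
    have hdev : ∀ {i : List Act}, (∀ j < i.length, i[j]? = w' j) →
        ¬ ∃ ρ ∈ deviating f w', IsPrefixOf ρ (Sum.inl (i.map f)) := by
      rintro i hi ⟨ρ, ⟨j, b, hb, hj⟩, ν, he⟩
      have hb' : (i.map f)[j]? = some b := by
        rw [← he, List.getElem?_append_left (List.getElem?_eq_some_iff.1 hb).1, hb]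
      rw [List.getElem?_map, Option.map_eq_some_iff] at hb'
      obtain ⟨a, ha, rfl⟩ := hb'
      exact hj a ((hi j (List.getElem?_eq_some_iff.1 ha).1).symm.trans ha) rfl
    rcases h with ⟨i, hi, p', hw, hd⟩ | ⟨s, hs, r, rfl, hr⟩ | ⟨i, hi, p', hw, hd⟩
    · exact hdev hi (hsat _ (Or.inl (Or.inr ⟨_, ⟨_, hrun hi hw, hF.diverges hd⟩, rfl⟩)))
    · have hinf : s.map f ∈ L.infTraces (F (some 0) (r 0)) :=
        ⟨fun n => F (some n) (r n), rfl, fun n => hF.weak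
          (run_testTransducer (i := [s.get n]) (by simpa using (hs n).symm)) (hr n)⟩
      obtain ⟨ρ, ⟨j, b, hb, hj⟩, ν, he⟩ := hsat _ (Or.inl (Or.inl ⟨_, hinf, rfl⟩))
      exact hj _ (hs j) (List.getElem_append_stream he hb).symm
    · exact hdev hi (hsat _ (Or.inr ⟨_, ⟨_, hrun hi hw, hd⟩, rfl⟩))

end Testing

/-! ### Full abstraction. -/

section FullAbstraction

variable {ops : Operators.{u, w, x} L} {O : Set (Oper.{u, x} Act)}

theorem ContextualPreorder.satisfiesLiveness {p q : L.State}
    (h : ContextualPreorder ops O L.livenessProperties p q) (C : Context L O)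
    {G : Set (List Act)} (hq : ¬ L.SatisfiesLiveness (C.fill ops q) G) :
    ¬ L.SatisfiesLiveness (C.fill ops p) G :=
  fun hp => hq (h C {r | L.SatisfiesLiveness r G} ⟨G, rfl⟩ hp)

/-- The contextual preorder for liveness properties is contained in the flooded preorder. -/
theorem ContextualPreorder.fdiBot [Infinite Act] (hL : Universal.{u, v, w} L) {g : Act}
    (hO : Oper.syncRenaming g ⊆ O) {p q : L.State}
    (h : ContextualPreorder ops O L.livenessProperties p q) : L.FDIBot p q := by
  obtain ⟨f, hf, hg⟩ := exists_injective_forall_ne g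
  have key : ∀ (w' : ℕ → Option Act) (E : ℕ → Set Act),
      (∀ i, ∀ b ∈ E i, ∀ a, w' i = some a → b ≠ f a) →
      ∃ F : Option ℕ → L.State → L.State, (testTransducer g f w' E).Realizes F ∧
        (¬ L.SatisfiesLiveness (F (some 0) q) (deviating f w') →
          ¬ L.SatisfiesLiveness (F (some 0) p) (deviating f w')) := by
    intro w' E hE
    obtain ⟨e, -, he⟩ := hL (testLTS.{u, v} f w' E)
    exact ⟨_, ops.test_realizes hg he, h.satisfiesLiveness
      (.parLeft {g}ᶜ (hO (Or.inl rfl))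
        (.lam (Interface.renaming f) PUnit.unit (hO (Or.inr ⟨f, hf, rfl⟩)) .hole) (e ⟨some 0⟩))⟩
  have hprefix : ∀ {σ i : List Act}, (∀ j < i.length, i[j]? = σ[j]?) → i <+: σ := by
    intro σ i hi
    refine List.prefix_iff_getElem?.2 fun j hj => ?_
    rw [← hi j hj, List.getElem?_eq_getElem hj]
  have hdiv : ∀ σ ∈ L.divergences q, σ ∈ L.divergencesBot p := by
    intro σ hσ
    have hE : ∀ i : ℕ, ∀ b ∈ ({g} : Set Act), ∀ a, σ[i]? = some a → b ≠ f a := by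
      rintro i b rfl a -
      exact (hg a).symm
    -- The test can do `g` in every state along the word, even at its end. This rules out deadlock,
    -- and an infinite trace cannot follow the finite `σ`.
    obtain ⟨F, hF, himp⟩ := key (fun j => σ[j]?) (fun _ => {g}) hE
    rw [not_satisfiesLiveness_deviating_iff hf hg hE hF,
      not_satisfiesLiveness_deviating_iff hf hg hE hF] at himp
    rcases himp (Or.inl ⟨σ, fun _ _ => rfl, hσ⟩) with ⟨i, hi, hd⟩ | ⟨s, hs, -⟩ | ⟨i, -, p', -, hd⟩
    · exact divergencesBot_of_prefix (mem_divergencesBot_of_mem hd) (hprefix hi)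
    · simpa using hs σ.length
    · exact absurd (hF.idle (k := some i.length) (k' := none) ⟨rfl, Set.mem_singleton g⟩) (hd _ _)
  refine ⟨?_, ?_, ?_⟩
  · rintro - ⟨σ, hσ, ρ, rfl⟩
    exact divergencesBot_append (hdiv σ hσ) ρ
  · rintro s (hs | ⟨σ, hσ, ρ, rfl⟩)
    · have hE : ∀ i : ℕ, ∀ b ∈ ({g} : Set Act), ∀ a, some (s.get i) = some a → b ≠ f a := by
        rintro i b rfl a -
        exact (hg a).symm
      obtain ⟨F, hF, himp⟩ := key (fun j => some (s.get j)) (fun _ => {g}) hE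
      rw [not_satisfiesLiveness_deviating_iff hf hg hE hF,
        not_satisfiesLiveness_deviating_iff hf hg hE hF] at himp
      rcases himp (Or.inr (Or.inl ⟨s, fun _ => rfl, hs⟩)) with
        ⟨i, hi, hd⟩ | ⟨s', hs', hinf⟩ | ⟨i, -, p', -, hd⟩
      · have : i = s.take i.length := by
          refine List.ext_getElem? fun j => ?_
          by_cases hj : j < i.length
          · rw [hi j hj, Stream'.getElem?_take hj]
          · rw [List.getElem?_eq_none (by omega),
              List.getElem?_eq_none (by rw [Stream'.length_take]; omega)]
        rw [← Stream'.append_take_drop i.length s, ← this]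
        exact infBot_of_divergencesBot (mem_divergencesBot_of_mem hd) _
      · obtain rfl : s = s' := Stream'.ext fun j => Option.some.inj (hs' j)
        exact Or.inl hinf
      · exact absurd (hF.idle (k := some i.length) (k' := none) ⟨rfl, Set.mem_singleton g⟩) (hd _ _)
    · exact infBot_of_divergencesBot (hdiv σ hσ) ρ
  · rintro ⟨o, X⟩ (hφ | ⟨σ, hσ, ρ, Y, he⟩)
    · have hE : ∀ i : ℕ, ∀ b ∈ (if i < o.length then {g} else f '' X : Set Act), ∀ a,
          o[i]? = some a → b ≠ f a := by
        intro i b hb a ha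
        rw [if_pos (List.getElem?_eq_some_iff.1 ha).1] at hb
        obtain rfl := hb
        exact (hg a).symm
      -- Offering `g` before the end of `o` prevents early deadlocks. At the end only `f '' X` is
      -- offered, so the composition deadlocks there iff the process is stable and refuses `X`.
      obtain ⟨F, hF, himp⟩ := key (fun j => o[j]?)
        (fun i => if i < o.length then {g} else f '' X) hE
      rw [not_satisfiesLiveness_deviating_iff hf hg hE hF,
        not_satisfiesLiveness_deviating_iff hf hg hE hF] at himp
      rw [mem_failuresBot_iff]
      obtain ⟨q', hq', hst, href⟩ := mem_failures_iff.1 hφ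
      have hend : ∀ b k, testTr f (fun j => o[j]?)
          (fun i => if i < o.length then {g} else f '' X) (some o.length) b k → b ∈ f '' X := by
        rintro b (_ | k) hk
        · simpa [testTr] using hk
        · obtain ⟨-, a, ha, -⟩ := hk
          simp at ha
      have hdead : L.Deadlocks (F (some o.length) q') := by
        intro α t ht
        rcases (hF _ _ _ _).1 ht with ⟨k, ⟨-, h⟩, -⟩ | ⟨a, k, r, ⟨-, h⟩, hr, -⟩ | ⟨-, r, hr, -⟩
        · obtain ⟨a, -, ha⟩ := hend _ _ h
          exact hg a ha
        · obtain ⟨a', ha', haa⟩ := hend _ _ h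
          obtain rfl := hf haa
          exact href _ ha' _ hr
        · exact hst _ hr
      rcases himp (Or.inr (Or.inr ⟨o, fun _ _ => rfl, q', hq', hdead⟩)) with
        ⟨i, hi, hd⟩ | ⟨s, hs, -⟩ | ⟨i, hi, p', hw, hd⟩
      · exact Or.inr (divergencesBot_of_prefix (mem_divergencesBot_of_mem hd) (hprefix hi))
      · simpa using hs o.length
      · left
        by_cases hlt : i.length < o.length
        · refine absurd (hF.idle (k' := none) ⟨rfl, ?_⟩) (hd _ _)
          simp [testTr, hlt]
        · obtain rfl : i = o :=
            (hprefix hi).eq_of_length (le_antisymm (hprefix hi).length_le (not_lt.1 hlt))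
          refine mem_failures_iff.2 ⟨p', hw, fun r hr => hd _ _ (hF.tau hr), fun a ha r hr => ?_⟩
          refine hd _ _ (hF.act (k' := none) ⟨rfl, ?_⟩ hr)
          simpa [testTr] using ⟨a, ha, rfl⟩
    · obtain ⟨rfl, rfl⟩ := Prod.mk.inj he
      exact failuresBot_of_divergencesBot (divergencesBot_append (hdiv σ hσ) ρ) _

theorem ContextualPreorder.of_fdiBot {p q : L.State} (h : L.FDIBot p q) :
    ContextualPreorder ops O L.livenessProperties p q := fun C =>
  FDIBot.respects_liveness _ _ ((FDIBot.isPrecongruence ops O).closed C p q h)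

theorem FDIBot.isFullyAbstract [Infinite Act] (hL : Universal.{u, v, w} L) {g : Act}
    (hO : Oper.syncRenaming g ⊆ O) : IsFullyAbstract ops O L.livenessProperties L.FDIBot where
  precongruence := FDIBot.isPrecongruence ops O
  respects := FDIBot.respects_liveness
  -- A precongruence that respects the liveness properties relates `C[p]` to `C[q]` for every
  -- context, and hence lies in the contextual preorder.
  coarsest _ hR hR' p q h :=
    ContextualPreorder.fdiBot hL hO fun C => hR' _ _ (hR.closed C p q h)

end FullAbstraction

end LTS

theorem mainTheorem2 {Act : Type u} [Infinite Act] (L : LTS.{u, w} Act)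
    (hL : LTS.Universal.{u, v, w} L) (ops : LTS.Operators.{u, w, x} L) :
    (∀ p q : L.State, LTS.LivenessPreorder ops p q ↔
      L.divergencesBot p ⊇ L.divergencesBot q ∧
      L.infBot p ⊇ L.infBot q ∧
      L.failuresBot p ⊇ L.failuresBot q) ∧
    LTS.IsFullyAbstract ops (Oper.all Act) L.livenessProperties L.FDIBot ∧
    (∀ (g : Act) (O : Set (Oper.{u, x} Act)), Oper.syncRenaming g ⊆ O →
      LTS.IsFullyAbstract ops O L.livenessProperties L.FDIBot) := by
  have hall : ∀ g : Act, Oper.syncRenaming g ⊆ Oper.all Act := fun _ => Set.subset_univ _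
  -- Any `g` will do: the class of all operators contains the tests for each of them.
  obtain ⟨g⟩ := (inferInstance : Nonempty Act)
  exact ⟨fun p q => ⟨fun h => LTS.ContextualPreorder.fdiBot hL (hall g) h,
    fun h => LTS.ContextualPreorder.of_fdiBot h⟩, LTS.FDIBot.isFullyAbstract hL (hall g),
    fun g O hO => LTS.FDIBot.isFullyAbstract hL hO⟩
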